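/- Let $G$ be a finite group. Say that $G$ realizes $\langle n_1,n_2,n_3\rangle$ if there are subsets $S_1,S_2,S_3\subseteq G$ with $|S_i|=n_i$ such that, whenever $q_i\in Q(S_i)=\{st^{-1}: s,t\in S_i\}$ for $i=1,2,3$ and $q_1q_2q_3=1$, one has $q_1=q_2=q_3=1$. For non-trivial $G$, let the pseudo-exponent $\alpha=\alpha(G)$ be the minimum of $\frac{3\log|G|}{\log (nmp)}$ over all positive integers $n,m,p$, not all equal to $1$, such that $G$ realizes $\langle n,m,p\rangle$; for trivial $G$ put $\alpha(G)=3$. Define $\gamma=\gamma(G)\in(0,\infty]$ so that $|G|^{1/\gamma}$ is the largest character degree of $G$, i.e. the largest dimension of an irreducible complex representation of $G$, with $\gamma(G)=\infty$ if $G$ is abelian. Let $\omega$ be the exponent of matrix multiplication over $\mathbb{C}$, i.e. the infimum of all real $\tau$ such that two $n\times n$ complex matrices can be multiplied with $O(n^{\tau})$ field operations. If $\alpha(G)<\gamma(G)$, then $$\omega\le\alpha\left(\frac{\gamma-2}{\gamma-\alpha}\right),$$ where for $\gamma=\infty$ the right-hand side is understood as its limit $\alpha$. -/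

import Mathlib

/-! ### Arithmetic complexity and the exponent of matrix multiplication -/

/-- `ArithComputation A s S`: starting from the set `A` of freely available functions on an input
space `X`, some straight-line program that carries out exactly `s` field operations
(additions, subtractions, multiplications and divisions, each applied to two functions that are
already available) makes exactly the functions in `S` available.  A division is allowed only if
the divisor does not vanish at any input, so that the program runs correctly on every input. -/
inductive ArithComputation {X : Type} (A : Set (X → ℂ)) : ℕ → Set (X → ℂ) → Prop
  | start : ArithComputation A 0 A
  | add {s : ℕ} {S : Set (X → ℂ)} {f g : X → ℂ} (hS : ArithComputation A s S) (hf : f ∈ S)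
      (hg : g ∈ S) : ArithComputation A (s + 1) (insert (fun x => f x + g x) S)
  | sub {s : ℕ} {S : Set (X → ℂ)} {f g : X → ℂ} (hS : ArithComputation A s S) (hf : f ∈ S)
      (hg : g ∈ S) : ArithComputation A (s + 1) (insert (fun x => f x - g x) S)
  | mul {s : ℕ} {S : Set (X → ℂ)} {f g : X → ℂ} (hS : ArithComputation A s S) (hf : f ∈ S)
      (hg : g ∈ S) : ArithComputation A (s + 1) (insert (fun x => f x * g x) S)
  | div {s : ℕ} {S : Set (X → ℂ)} {f g : X → ℂ} (hS : ArithComputation A s S) (hf : f ∈ S)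
      (hg : g ∈ S) (hne : ∀ x, g x ≠ 0) :
      ArithComputation A (s + 1) (insert (fun x => f x / g x) S)

/-- A pair of complex `n × n` matrices. -/
abbrev MatrixPair (n : ℕ) : Type := Matrix (Fin n) (Fin n) ℂ × Matrix (Fin n) (Fin n) ℂ

/-- What a program for `n × n` matrix multiplication may use for free: the entries of the two
matrices, and the complex constants. -/
def matMulInputs (n : ℕ) : Set (MatrixPair n → ℂ) :=
  {f | (∃ i j, f = fun p => p.1 i j) ∨ (∃ i j, f = fun p => p.2 i j) ∨ ∃ c : ℂ, f = fun _ => c}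

/-- Two complex `n × n` matrices can be multiplied with `s` field operations. -/
def CanMultiplyIn (n s : ℕ) : Prop :=
  ∃ S : Set (MatrixPair n → ℂ), ArithComputation (matMulInputs n) s S ∧
    ∀ i j, (fun p : MatrixPair n => (p.1 * p.2) i j) ∈ S

/-- The real numbers `τ` such that `n × n` matrices over `ℂ` can be multiplied with `O(n ^ τ)`
field operations. -/
def matMulExponents : Set ℝ :=
  {τ | ∃ C : ℝ, ∀ n : ℕ, 1 ≤ n → ∃ s : ℕ, (s : ℝ) ≤ C * (n : ℝ) ^ τ ∧ CanMultiplyIn n s}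

/-- The exponent `ω` of matrix multiplication over `ℂ`. -/
noncomputable def matMulExponent : ℝ := sInf matMulExponents

theorem ArithComputation.exists_dot {n : ℕ} {s : ℕ} {S : Set (MatrixPair n → ℂ)}
    (hS : ArithComputation (matMulInputs n) s S) (hA : matMulInputs n ⊆ S) (i j : Fin n)
    (T : Finset (Fin n)) :
    ∃ S', S ⊆ S' ∧ ArithComputation (matMulInputs n) (s + T.card * 2) S' ∧
      (fun p : MatrixPair n => ∑ k ∈ T, p.1 i k * p.2 k j) ∈ S' := by
  classical
  induction T using Finset.induction_on with
  | empty =>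
    refine ⟨S, subset_rfl, by simpa using hS, hA (Or.inr (Or.inr ⟨0, ?_⟩))⟩
    simp
  | insert a T ha ih =>
    obtain ⟨S', h1, h2, h3⟩ := ih
    have h4 := ArithComputation.mul h2 (f := fun p => p.1 i a) (g := fun p => p.2 a j)
      (h1 (hA (Or.inl ⟨i, a, rfl⟩))) (h1 (hA (Or.inr (Or.inl ⟨a, j, rfl⟩))))
    have h5 := ArithComputation.add h4 (Set.mem_insert _ _) (Set.mem_insert_of_mem _ h3)
    have hfun : (fun p : MatrixPair n => ∑ k ∈ insert a T, p.1 i k * p.2 k j) =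
        fun p => p.1 i a * p.2 a j + ∑ k ∈ T, p.1 i k * p.2 k j := by
      funext p
      rw [Finset.sum_insert ha]
    rw [Finset.card_insert_of_notMem ha, add_mul, one_mul, ← add_assoc, hfun]
    exact ⟨_, (h1.trans (Set.subset_insert _ _)).trans (Set.subset_insert _ _), h5,
      Set.mem_insert _ _⟩

/-- The school method. -/
theorem canMultiplyIn_naive (n : ℕ) : CanMultiplyIn n (2 * n ^ 3) := by
  classical
  have key : ∀ U : Finset (Fin n × Fin n), ∃ S, matMulInputs n ⊆ S ∧
      ArithComputation (matMulInputs n) (U.card * (n * 2)) S ∧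
      ∀ q ∈ U, (fun p : MatrixPair n => (p.1 * p.2) q.1 q.2) ∈ S := by
    intro U
    induction U using Finset.induction_on with
    | empty => exact ⟨_, subset_rfl, by simpa using ArithComputation.start, by simp⟩
    | insert a U ha ih =>
      obtain ⟨S, h1, h2, h3⟩ := ih
      obtain ⟨S', h4, h5, h6⟩ := h2.exists_dot h1 a.1 a.2 Finset.univ
      refine ⟨S', h1.trans h4, ?_, ?_⟩
      · rw [Finset.card_insert_of_notMem ha, add_mul, one_mul]
        simpa using h5
      · intro q hq
        rcases Finset.mem_insert.1 hq with rfl | hq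
        · simpa only [Matrix.mul_apply] using h6
        · exact h4 (h3 q hq)
  obtain ⟨S, -, h2, h3⟩ := key Finset.univ
  refine ⟨S, ?_, fun i j => h3 (i, j) (Finset.mem_univ _)⟩
  have : 2 * n ^ 3 = (Finset.univ : Finset (Fin n × Fin n)).card * (n * 2) := by
    simp; ring
  rw [this]
  exact h2

theorem three_mem_matMulExponents : (3 : ℝ) ∈ matMulExponents := by
  refine ⟨2, fun n _ => ⟨2 * n ^ 3, ?_, canMultiplyIn_naive n⟩⟩
  norm_cast

theorem not_canMultiplyIn_zero {n : ℕ} (hn : 1 ≤ n) : ¬ CanMultiplyIn n 0 := by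
  rintro ⟨S, hS, h⟩
  have hA : S = matMulInputs n := by
    cases hS
    rfl
  subst hA
  let i : Fin n := ⟨0, hn⟩
  have hv : ∀ c : ℂ, ((c • (1 : Matrix (Fin n) (Fin n) ℂ)) * (c • 1)) i i = c * c := by
    intro c; simp
  rcases h i i with ⟨a, b, hf⟩ | ⟨a, b, hf⟩ | ⟨c, hf⟩
  · have h1 := congrFun hf ((1 : ℂ) • 1, (1 : ℂ) • 1)
    have h2 := congrFun hf ((2 : ℂ) • 1, (2 : ℂ) • 1)
    simp only [hv, Matrix.smul_apply, smul_eq_mul] at h1 h2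
    rw [one_mul, one_mul] at h1
    rw [← h1] at h2
    norm_num at h2
  · have h1 := congrFun hf ((1 : ℂ) • 1, (1 : ℂ) • 1)
    have h2 := congrFun hf ((2 : ℂ) • 1, (2 : ℂ) • 1)
    simp only [hv, Matrix.smul_apply, smul_eq_mul] at h1 h2
    rw [one_mul, one_mul] at h1
    rw [← h1] at h2
    norm_num at h2
  · have h1 := congrFun hf ((1 : ℂ) • 1, (1 : ℂ) • 1)
    have h2 := congrFun hf ((2 : ℂ) • 1, (2 : ℂ) • 1)
    simp only [hv] at h1 h2
    rw [← h1] at h2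
    norm_num at h2

theorem bddBelow_matMulExponents : BddBelow matMulExponents := by
  refine ⟨0, ?_⟩
  rintro τ ⟨C, hC⟩
  by_contra! hτ
  have ht : Filter.Tendsto (fun n : ℕ => C * (n : ℝ) ^ τ) Filter.atTop (nhds (C * 0)) := by
    have h := (tendsto_rpow_neg_atTop (y := -τ) (by linarith)).comp
      (tendsto_natCast_atTop_atTop (R := ℝ))
    simp only [neg_neg] at h
    exact h.const_mul C
  rw [mul_zero] at ht
  obtain ⟨n, h1, h2⟩ := ((ht.eventually (gt_mem_nhds one_pos)).and
    (Filter.eventually_ge_atTop 1)).exists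
  obtain ⟨s, hs, hm⟩ := hC n h2
  have : s = 0 := by
    have : (s : ℝ) < 1 := hs.trans_lt h1
    have : s < 1 := by exact_mod_cast this
    omega
  exact not_canMultiplyIn_zero h2 (this ▸ hm)

/-! ### The triple product property and the pseudo-exponent -/

/-- The right quotient set `Q(S) = {s₁ s₂⁻¹ : s₁, s₂ ∈ S}`. -/
def rightQuotientSet {G : Type*} [Group G] (S : Finset G) : Set G :=
  {q | ∃ s₁ ∈ S, ∃ s₂ ∈ S, q = s₁ * s₂⁻¹}

def TripleProductProperty {G : Type*} [Group G] (S₁ S₂ S₃ : Finset G) : Prop :=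
  ∀ q₁ ∈ rightQuotientSet S₁, ∀ q₂ ∈ rightQuotientSet S₂, ∀ q₃ ∈ rightQuotientSet S₃,
    q₁ * q₂ * q₃ = 1 → q₁ = 1 ∧ q₂ = 1 ∧ q₃ = 1

/-- `G` realizes `⟨n₁, n₂, n₃⟩`. -/
def Realizes (G : Type*) [Group G] (n₁ n₂ n₃ : ℕ) : Prop :=
  ∃ S₁ S₂ S₃ : Finset G, S₁.card = n₁ ∧ S₂.card = n₂ ∧ S₃.card = n₃ ∧
    TripleProductProperty S₁ S₂ S₃

/-- The numbers `3 log |G| / log (nmp)`, where `n, m, p` are positive and not all `1` (that is,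
`nmp > 1`) and `G` realizes `⟨n, m, p⟩`. -/
def pseudoExponentValues (G : Type*) [Group G] : Set ℝ :=
  {a | ∃ n m p : ℕ, 1 < n * m * p ∧ Realizes G n m p ∧
    a = 3 * Real.log (Nat.card G) / Real.log ((n * m * p : ℕ) : ℝ)}

open Classical in
/-- The pseudo-exponent `α(G)` of a finite group: the minimum of the above numbers if `G` is
non-trivial, and `3` if `G` is trivial. -/
noncomputable def pseudoExponent (G : Type*) [Group G] : ℝ :=
  if Nontrivial G then sInf (pseudoExponentValues G) else 3

theorem pseudoExponent_isLeast (G : Type*) [Group G] [Finite G] [Nontrivial G] :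
    IsLeast (pseudoExponentValues G) (pseudoExponent G) := by
  classical
  have := Fintype.ofFinite G
  have hfin : (pseudoExponentValues G).Finite := by
    let F : ℕ × ℕ × ℕ → ℝ := fun t =>
      3 * Real.log (Nat.card G) / Real.log ((t.1 * t.2.1 * t.2.2 : ℕ) : ℝ)
    let N := Fintype.card G
    refine (((Set.finite_Iic N).prod ((Set.finite_Iic N).prod (Set.finite_Iic N))).image
      F).subset ?_
    rintro a ⟨n, m, p, -, ⟨S₁, S₂, S₃, rfl, rfl, rfl, -⟩, rfl⟩
    exact ⟨(S₁.card, S₂.card, S₃.card),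
      ⟨S₁.card_le_univ, S₂.card_le_univ, S₃.card_le_univ⟩, rfl⟩
  have hne : (pseudoExponentValues G).Nonempty := by
    refine ⟨_, 1, 1, Nat.card G, ?_, ⟨{1}, {1}, Finset.univ, by simp, by simp, by simp, ?_⟩, rfl⟩
    · simpa using Finite.one_lt_card (α := G)
    · rintro q₁ ⟨a, ha, b, hb, rfl⟩ q₂ ⟨c, hc, d, hd, rfl⟩ q₃ - h
      simp_all
  rw [pseudoExponent, if_pos (inferInstance : Nontrivial G)]
  exact ⟨hne.csInf_mem hfin, fun a ha => csInf_le hfin.bddBelow ha⟩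

/-! ### Character degrees -/

/-- The character degrees of `G`: the dimensions of its irreducible complex representations. -/
def characterDegrees (G : Type*) [Group G] : Set ℕ :=
  {d | ∃ ρ : Representation ℂ G (Fin d → ℂ), ρ.IsIrreducible}

/-- The largest character degree of a finite group. -/
noncomputable def maxCharacterDegree (G : Type*) [Group G] : ℕ := sSup (characterDegrees G)

open Classical in
/-- `γ(G)`, the element of `(0, ∞]` with `|G| ^ (1 / γ(G))` equal to the largest character
degree; it is `∞` if `G` is abelian. -/
noncomputable def degreeExponent (G : Type*) [Group G] : EReal :=
  if ∀ a b : G, a * b = b * a then ⊤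
  else ((Real.log (Nat.card G) / Real.log (maxCharacterDegree G) : ℝ) : EReal)

theorem bddAbove_characterDegrees (G : Type*) [Group G] [Finite G] :
    BddAbove (characterDegrees G) := by
  have := Fintype.ofFinite G
  refine ⟨Fintype.card G, ?_⟩
  rintro d ⟨ρ, hρ⟩
  have hnt : Nontrivial (Fin d → ℂ) := by
    by_contra hcon
    rw [not_nontrivial_iff_subsingleton] at hcon
    have := hρ.toNontrivial
    obtain ⟨x, y, hxy⟩ := exists_pair_ne (Subrepresentation ρ)
    refine hxy (SetLike.ext fun v => ?_)
    rw [Subsingleton.elim v 0]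
    exact ⟨fun _ => y.toSubmodule.zero_mem, fun _ => x.toSubmodule.zero_mem⟩
  obtain ⟨v, hv⟩ := exists_ne (0 : Fin d → ℂ)
  let W : Subrepresentation ρ :=
    { toSubmodule := Submodule.span ℂ (Set.range fun g => ρ g v)
      apply_mem_toSubmodule := by
        intro g w hw
        induction hw using Submodule.span_induction with
        | mem x hx =>
          obtain ⟨h, rfl⟩ := hx
          exact Submodule.subset_span ⟨g * h, by simp⟩
        | zero => simp
        | add x y _ _ hx hy => rw [map_add]; exact Submodule.add_mem _ hx hy
        | smul c x _ hx => rw [map_smul]; exact Submodule.smul_mem _ c hx }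
  have hvW : v ∈ W.toSubmodule := Submodule.subset_span ⟨1, by simp⟩
  have hW : W = ⊤ := by
    rcases hρ.eq_bot_or_eq_top W with h | h
    · rw [h] at hvW
      exact absurd hvW hv
    · exact h
  have hspan : Submodule.span ℂ (Set.range fun g => ρ g v) = ⊤ :=
    congrArg Subrepresentation.toSubmodule hW
  have := finrank_range_le_card (R := ℂ) (fun g => ρ g v)
  rw [Set.finrank, hspan] at this
  simpa using this

theorem one_mem_characterDegrees (G : Type*) [Group G] : 1 ∈ characterDegrees G := by
  refine ⟨1, ?_⟩
  have hbt : ∀ W : Submodule ℂ (Fin 1 → ℂ), W = ⊥ ∨ W = ⊤ := by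
    have : IsSimpleModule ℂ (Fin 1 → ℂ) :=
      IsSimpleModule.congr (LinearEquiv.funUnique (Fin 1) ℂ ℂ)
    exact fun W => eq_bot_or_eq_top W
  refine { exists_pair_ne := ⟨⊥, ⊤, fun h => ?_⟩, eq_bot_or_eq_top := fun W => ?_ }
  · have h' : (⊥ : Submodule ℂ (Fin 1 → ℂ)) = ⊤ := congrArg Subrepresentation.toSubmodule h
    exact bot_ne_top h'
  · rcases hbt W.toSubmodule with h | h
    · left
      refine SetLike.ext fun v => ?_
      change v ∈ W.toSubmodule ↔ v ∈ (⊥ : Submodule ℂ (Fin 1 → ℂ))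
      rw [h]
    · right
      refine SetLike.ext fun v => ?_
      change v ∈ W.toSubmodule ↔ v ∈ (⊤ : Submodule ℂ (Fin 1 → ℂ))
      rw [h]

theorem card_rpow_inv_degreeExponent (G : Type*) [Group G] [Finite G]
    (hG : ¬ ∀ a b : G, a * b = b * a) :
    (Nat.card G : ℝ) ^ (1 / (degreeExponent G).toReal) = maxCharacterDegree G := by
  have hnt : Nontrivial G := by
    push Not at hG
    obtain ⟨a, b, hab⟩ := hG
    exact ⟨_, _, hab⟩
  have hc : 1 < Nat.card G := Finite.one_lt_card
  have hlog : Real.log (Nat.card G) ≠ 0 := (Real.log_pos (by exact_mod_cast hc)).ne'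
  have hd : 1 ≤ maxCharacterDegree G :=
    le_csSup (bddAbove_characterDegrees G) (one_mem_characterDegrees G)
  rw [degreeExponent, if_neg hG, EReal.toReal_coe,
    Real.rpow_def_of_pos (by exact_mod_cast (by omega : 0 < Nat.card G)), one_div_div,
    mul_div_cancel₀ _ hlog, Real.exp_log (by exact_mod_cast hd)]

/-!
A straight-line program for a bilinear map yields a decomposition of the map into few products of
linear forms: restrict everything to lines through the origin and keep the parts of degree at most
two. Over `ℂ` a divisor without zeros is constant on every line, so divisions cost nothing, and
each multiplication adds one product of linear forms. Conversely, a decomposition of `N × N` matrix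
multiplication into `r` products can be applied recursively to block matrices. Hence `ω` measures
bilinear rank equally well, and `N ^ ω ≤ r` for every such decomposition.

If `G` realizes `⟨N, N, N⟩`, then `N × N` matrix multiplication embeds into the multiplication of
the group algebra, which by Wedderburn is a product of matrix algebras of sizes `dᵢ`; so `N ^ ω` is
at most the sum of the ranks of `dᵢ × dᵢ` matrix multiplications. Passing to powers of `G` removes
the constants and gives `N ^ ω ≤ ∑ dᵢ ^ ω`. Applied to `G × G × G` and the three rotations of a
triple this becomes `(nmp) ^ ω ≤ (∑ dᵢ ^ ω) ^ 3`, where `∑ dᵢ ^ ω ≤ (max dᵢ) ^ (ω - 2) * |G|` since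
`∑ dᵢ ^ 2 = |G|` and `ω ≥ 2`. Taking logarithms yields the bound.
-/

/-! ### Bilinear rank -/

section BilinRank

variable {R U V W U' V' W' : Type*} [AddCommMonoid U] [AddCommMonoid V]
  [AddCommMonoid U'] [AddCommMonoid V']

section CommSemiring

variable [CommSemiring R] [AddCommMonoid W] [AddCommMonoid W'] [Module R U] [Module R V]
  [Module R W] [Module R U'] [Module R V'] [Module R W']

/-- The bilinear map `φ` has rank at most `r` as a tensor: it is a sum of `r` terms, each the
product of a linear form in the first argument, a linear form in the second one and a fixed
vector. -/
def BilinRankLE (φ : U →ₗ[R] V →ₗ[R] W) (r : ℕ) : Prop :=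
  ∃ (u : Fin r → U →ₗ[R] R) (v : Fin r → V →ₗ[R] R) (w : Fin r → W),
    ∀ x y, φ x y = ∑ k, (u k x * v k y) • w k

namespace BilinRankLE

variable {φ : U →ₗ[R] V →ₗ[R] W} {r : ℕ}

theorem of_fintype {ι : Type*} [Fintype ι] (u : ι → U →ₗ[R] R) (v : ι → V →ₗ[R] R) (w : ι → W)
    (h : ∀ x y, φ x y = ∑ k, (u k x * v k y) • w k) : BilinRankLE φ (Fintype.card ι) := by
  let e := (Fintype.equivFin ι).symm
  refine ⟨u ∘ e, v ∘ e, w ∘ e, fun x y => ?_⟩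
  rw [h, ← e.sum_comp]
  rfl

theorem comp (h : BilinRankLE φ r) {φ' : U' →ₗ[R] V' →ₗ[R] W'} (f : U' →ₗ[R] U) (g : V' →ₗ[R] V)
    (k : W →ₗ[R] W') (hφ' : ∀ x y, φ' x y = k (φ (f x) (g y))) : BilinRankLE φ' r := by
  obtain ⟨u, v, w, h⟩ := h
  exact ⟨fun i => u i ∘ₗ f, fun i => v i ∘ₗ g, fun i => k (w i), fun x y => by simp [hφ', h]⟩

theorem sum {ι : Type*} [Fintype ι] {φ : ι → U →ₗ[R] V →ₗ[R] W} {r : ι → ℕ}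
    (h : ∀ i, BilinRankLE (φ i) (r i)) : BilinRankLE (∑ i, φ i) (∑ i, r i) := by
  choose u v w h using h
  have := of_fintype (φ := ∑ i, φ i) (ι := Σ i, Fin (r i)) (fun p => u p.1 p.2)
    (fun p => v p.1 p.2) (fun p => w p.1 p.2) fun x y => by
      simp only [LinearMap.sum_apply, h, Fintype.sum_sigma]
  simpa using this

end BilinRankLE

end CommSemiring

namespace BilinRankLE

theorem finrank_le [CommRing R] [StrongRankCondition R] {U V W : Type*} [AddCommGroup U]
    [AddCommMonoid V] [AddCommMonoid W] [Module R U] [Module R V] [Module R W]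
    {φ : U →ₗ[R] V →ₗ[R] W} {r : ℕ} (h : BilinRankLE φ r) (hφ : Function.Injective φ) :
    Module.finrank R U ≤ r := by
  obtain ⟨u, v, w, h⟩ := h
  have hu : Function.Injective (LinearMap.pi u) := by
    refine (injective_iff_map_eq_zero _).2 fun x hx => (injective_iff_map_eq_zero φ).1 hφ x ?_
    have hx' : ∀ k, u k x = 0 := congrFun hx
    ext y
    simp [h, hx']
  simpa using LinearMap.finrank_le_finrank_of_injective hu

/-- Only the mixed terms of the quadratic forms `l k * m k` contribute to `φ x y`, and there are
two of them for each `k`. -/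
theorem of_quadratic [CommRing R] [AddCommGroup W] [Module R U] [Module R V] [Module R W]
    {φ : U →ₗ[R] V →ₗ[R] W} {s : ℕ} (l m : Fin s → U × V →ₗ[R] R) (w : Fin s → W)
    (h : ∀ x y, φ x y = ∑ k, (l k (x, y) * m k (x, y)) • w k) : BilinRankLE φ (2 * s) := by
  have key := of_fintype (φ := φ)
    (Sum.elim (fun k => l k ∘ₗ .inl R U V) fun k => m k ∘ₗ .inl R U V)
    (Sum.elim (fun k => m k ∘ₗ .inr R U V) fun k => l k ∘ₗ .inr R U V)
    (Sum.elim w w) fun x y => by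
      have split : ∀ f : U × V →ₗ[R] R, f (x, y) = f (x, 0) + f (0, y) := fun f => by
        rw [← map_add, Prod.mk_add_mk, add_zero, zero_add]
      calc φ x y = φ x y - φ x 0 - φ 0 y := by simp
        _ = _ := by
          simp only [h, split, Fintype.sum_sum_type, Sum.elim_inl, Sum.elim_inr,
            LinearMap.comp_apply, LinearMap.inl_apply, LinearMap.inr_apply,
            ← Finset.sum_sub_distrib, ← Finset.sum_add_distrib, ← sub_smul, ← add_smul]
          congr! 2 with k
          ring
  simpa [two_mul] using key

end BilinRankLE

end BilinRank

/-- Multiplication of `l × m` by `m × n` matrices over `R` has bilinear rank at most `r`. -/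
def MatMulRankLE (R l m n : Type*) [CommSemiring R] [Fintype m] (r : ℕ) : Prop :=
  BilinRankLE (mulLinearMap R : Matrix l m R →ₗ[R] Matrix m n R →ₗ[R] Matrix l n R) r

namespace MatMulRankLE

variable {R l m n l' m' n' : Type*} [Fintype m] [Fintype m'] {r : ℕ}

theorem congr [CommSemiring R] (h : MatMulRankLE R l m n r) (el : l' ≃ l) (em : m' ≃ m)
    (en : n' ≃ n) : MatMulRankLE R l' m' n' r := by
  refine BilinRankLE.comp h (Matrix.reindexLinearEquiv R R el em).toLinearMap
    (Matrix.reindexLinearEquiv R R em en).toLinearMap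
    (Matrix.reindexLinearEquiv R R el.symm en.symm).toLinearMap fun A B => ?_
  ext i j
  simp [Matrix.mul_apply, ← em.symm.sum_comp]

theorem card_mul_card_le [CommRing R] [StrongRankCondition R] [Fintype l] [Nonempty n]
    (h : MatMulRankLE R l m n r) : Fintype.card l * Fintype.card m ≤ r := by
  classical
  have hinj : Function.Injective
      (mulLinearMap R : Matrix l m R →ₗ[R] Matrix m n R →ₗ[R] Matrix l n R) := by
    intro A B hAB
    obtain ⟨j⟩ := ‹Nonempty n›
    ext i k
    simpa using congrFun (congrFun (LinearMap.congr_fun hAB (Matrix.single k j 1)) i) j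
  simpa [Module.finrank_matrix] using BilinRankLE.finrank_le h hinj

end MatMulRankLE

/-! ### From straight-line programs to bilinear rank -/

section QuadraticPart

variable {R V : Type*} [AddCommMonoid V]

/-- The functions on `V` that are polynomial along every line through the origin, with a constant
term that does not depend on the line, a first-order coefficient that is a linear form, and a
second-order coefficient in the space `Q` of functions. -/
def quadraticPartIn [CommRing R] [Module R V] (Q : Submodule R (V → R)) :
    Submodule R (V → R) where
  carrier := {f | ∃ (c : R) (l : V →ₗ[R] R), ∃ q ∈ Q, ∀ x, ∃ p : Polynomial R,
    (∀ t : R, f (t • x) = p.eval t) ∧ p.coeff 0 = c ∧ p.coeff 1 = l x ∧ p.coeff 2 = q x}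
  zero_mem' := ⟨0, 0, 0, Q.zero_mem, fun _ => ⟨0, by simp⟩⟩
  add_mem' := by
    rintro f g ⟨c, l, q, hq, hf⟩ ⟨c', l', q', hq', hg⟩
    refine ⟨c + c', l + l', q + q', Q.add_mem hq hq', fun x => ?_⟩
    obtain ⟨p, hp, h0, h1, h2⟩ := hf x
    obtain ⟨p', hp', h0', h1', h2'⟩ := hg x
    exact ⟨p + p', by simp [hp, hp', h0, h0', h1, h1', h2, h2']⟩
  smul_mem' := by
    rintro a f ⟨c, l, q, hq, hf⟩
    refine ⟨a * c, a • l, a • q, Q.smul_mem a hq, fun x => ?_⟩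
    obtain ⟨p, hp, h0, h1, h2⟩ := hf x
    exact ⟨Polynomial.C a * p, by simp [hp, h0, h1, h2]⟩

namespace quadraticPartIn

section CommRing

variable [CommRing R] [Module R V] {Q Q' : Submodule R (V → R)} {f g : V → R}

theorem mono (h : Q ≤ Q') : quadraticPartIn Q ≤ quadraticPartIn Q' := by
  rintro f ⟨c, l, q, hq, hf⟩
  exact ⟨c, l, q, h hq, hf⟩

theorem const_mem (c : R) : (fun _ => c) ∈ quadraticPartIn Q :=
  ⟨c, 0, 0, Q.zero_mem, fun _ => ⟨Polynomial.C c, by simp [Polynomial.coeff_C]⟩⟩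

theorem linear_mem (l : V →ₗ[R] R) : ⇑l ∈ quadraticPartIn Q :=
  ⟨0, l, 0, Q.zero_mem, fun x => ⟨Polynomial.C (l x) * Polynomial.X,
    fun t => by simp [mul_comm t], by simp, by simp, by simp⟩⟩

theorem exists_mul_mem (hf : f ∈ quadraticPartIn Q) (hg : g ∈ quadraticPartIn Q) :
    ∃ l m : V →ₗ[R] R, f * g ∈ quadraticPartIn (Submodule.span R {⇑l * ⇑m} ⊔ Q) := by
  obtain ⟨c, l, q, hq, hf⟩ := hf
  obtain ⟨c', l', q', hq', hg⟩ := hg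
  refine ⟨l, l', c * c', c • l' + c' • l, ⇑l * ⇑l' + (c • q' + c' • q),
    Submodule.add_mem_sup (Submodule.mem_span_singleton_self _)
      (Q.add_mem (Q.smul_mem c hq') (Q.smul_mem c' hq)), fun x => ?_⟩
  obtain ⟨p, hp, h0, h1, h2⟩ := hf x
  obtain ⟨p', hp', h0', h1', h2'⟩ := hg x
  refine ⟨p * p', fun t => by simp [hp, hp'], by simp [Polynomial.mul_coeff_zero, h0, h0'], ?_, ?_⟩
  · simp only [Polynomial.mul_coeff_one, h0, h0', h1, h1', LinearMap.add_apply,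
      LinearMap.smul_apply, smul_eq_mul]
    ring
  · simp only [Polynomial.coeff_mul, Finset.Nat.sum_antidiagonal_eq_sum_range_succ_mk,
      Finset.sum_range_succ, Finset.sum_range_zero, Nat.reduceSub, h0, h0', h1, h1', h2, h2',
      Pi.add_apply, Pi.mul_apply, Pi.smul_apply, smul_eq_mul]
    ring

theorem mem_of_homogeneous [IsDomain R] [Infinite R] (hf : f ∈ quadraticPartIn Q)
    (h2 : ∀ (t : R) x, f (t • x) = t ^ 2 * f x) : f ∈ Q := by
  obtain ⟨c, l, q, hq, hf⟩ := hf
  suffices f = q by rwa [this]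
  funext x
  obtain ⟨p, hp, -, -, hpq⟩ := hf x
  have : p = Polynomial.C (f x) * Polynomial.X ^ 2 :=
    Polynomial.funext fun t => by rw [← hp, h2, mul_comm]; simp
  simp [← hpq, this]

end CommRing

section IsAlgClosed

variable [Field R] [IsAlgClosed R] [Module R V] {Q : Submodule R (V → R)} {f g : V → R}

theorem eq_const_of_ne_zero (hg : g ∈ quadraticPartIn Q) (hne : ∀ x, g x ≠ 0) :
    ∃ c, g = fun _ => c := by
  obtain ⟨c, l, q, -, hg⟩ := hg
  refine ⟨c, funext fun x => ?_⟩
  obtain ⟨p, hp, h0, -, -⟩ := hg x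
  have hdeg : p.degree = 0 := by
    by_contra hd
    obtain ⟨t, ht⟩ := IsAlgClosed.exists_root p hd
    exact hne (t • x) ((hp t).trans ht)
  have hp1 := hp 1
  rwa [Polynomial.eq_C_of_degree_eq_zero hdeg, one_smul, Polynomial.eval_C, h0] at hp1

theorem div_mem (hf : f ∈ quadraticPartIn Q) (hg : g ∈ quadraticPartIn Q) (hne : ∀ x, g x ≠ 0) :
    f / g ∈ quadraticPartIn Q := by
  obtain ⟨c, rfl⟩ := eq_const_of_ne_zero hg hne
  convert (quadraticPartIn Q).smul_mem c⁻¹ hf using 1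
  ext x
  simp [div_eq_inv_mul]

end IsAlgClosed

end quadraticPartIn

end QuadraticPart

/-- Each operation contributes at most one product of linear forms to the quadratic parts. -/
theorem ArithComputation.exists_subset_quadraticPartIn {V : Type} [AddCommMonoid V] [Module ℂ V]
    {A S : Set (V → ℂ)} {s : ℕ} (hS : ArithComputation A s S)
    (hA : A ⊆ quadraticPartIn (⊥ : Submodule ℂ (V → ℂ))) :
    ∃ l m : Fin s → V →ₗ[ℂ] ℂ,
      S ⊆ quadraticPartIn (Submodule.span ℂ (Set.range fun k => ⇑(l k) * ⇑(m k))) := by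
  have step {s : ℕ} {S : Set (V → ℂ)} {f : V → ℂ} {l m : Fin s → V →ₗ[ℂ] ℂ} (a b : V →ₗ[ℂ] ℂ)
      (hS : S ⊆ quadraticPartIn (Submodule.span ℂ (Set.range fun k => ⇑(l k) * ⇑(m k))))
      (hf : f ∈ quadraticPartIn (Submodule.span ℂ {⇑a * ⇑b} ⊔
        Submodule.span ℂ (Set.range fun k => ⇑(l k) * ⇑(m k)))) :
      ∃ l' m' : Fin (s + 1) → V →ₗ[ℂ] ℂ, insert f S ⊆
        quadraticPartIn (Submodule.span ℂ (Set.range fun k => ⇑(l' k) * ⇑(m' k))) := by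
    refine ⟨Fin.cons a l, Fin.cons b m, ?_⟩
    have hrange : (Set.range fun k => ⇑((Fin.cons a l : Fin (s + 1) → V →ₗ[ℂ] ℂ) k) *
        ⇑((Fin.cons b m : Fin (s + 1) → V →ₗ[ℂ] ℂ) k)) =
        insert (⇑a * ⇑b) (Set.range fun k => ⇑(l k) * ⇑(m k)) := by
      rw [← Fin.range_cons]
      congr 1
      exact funext (Fin.cases rfl fun _ => rfl)
    rw [hrange, Submodule.span_insert]
    exact Set.insert_subset hf (hS.trans (quadraticPartIn.mono le_sup_right))
  induction hS with
  | start => exact ⟨Fin.elim0, Fin.elim0, hA.trans (quadraticPartIn.mono bot_le)⟩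
  | add _ hf hg ih =>
    obtain ⟨l, m, h⟩ := ih
    exact step 0 0 h (quadraticPartIn.mono le_sup_right (add_mem (h hf) (h hg)))
  | sub _ hf hg ih =>
    obtain ⟨l, m, h⟩ := ih
    exact step 0 0 h (quadraticPartIn.mono le_sup_right (sub_mem (h hf) (h hg)))
  | mul _ hf hg ih =>
    obtain ⟨l, m, h⟩ := ih
    obtain ⟨a, b, hab⟩ := quadraticPartIn.exists_mul_mem (h hf) (h hg)
    exact step a b h hab
  | div _ hf hg hne ih =>
    obtain ⟨l, m, h⟩ := ih
    exact step 0 0 h (quadraticPartIn.mono le_sup_right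
      (quadraticPartIn.div_mem (h hf) (h hg) hne))

theorem matMulInputs_subset_quadraticPartIn (n : ℕ) (Q : Submodule ℂ (MatrixPair n → ℂ)) :
    matMulInputs n ⊆ quadraticPartIn Q := by
  rintro f (⟨i, j, rfl⟩ | ⟨i, j, rfl⟩ | ⟨c, rfl⟩)
  · exact quadraticPartIn.linear_mem (Matrix.entryLinearMap ℂ ℂ i j ∘ₗ LinearMap.fst ℂ _ _)
  · exact quadraticPartIn.linear_mem (Matrix.entryLinearMap ℂ ℂ i j ∘ₗ LinearMap.snd ℂ _ _)
  · exact quadraticPartIn.const_mem c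

theorem CanMultiplyIn.matMulRankLE {n s : ℕ} (h : CanMultiplyIn n s) :
    MatMulRankLE ℂ (Fin n) (Fin n) (Fin n) (2 * s) := by
  obtain ⟨S, hS, hout⟩ := h
  obtain ⟨l, m, hq⟩ :=
    hS.exists_subset_quadraticPartIn (matMulInputs_subset_quadraticPartIn n ⊥)
  have hentry : ∀ i j, ∃ c : Fin s → ℂ, ∀ A B : Matrix (Fin n) (Fin n) ℂ,
      (A * B) i j = ∑ k, l k (A, B) * m k (A, B) * c k := by
    intro i j
    have hspan := quadraticPartIn.mem_of_homogeneous (hq (hout i j)) fun t x => by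
      simp [pow_two, mul_assoc]
    obtain ⟨c, hc⟩ := (Submodule.mem_span_range_iff_exists_fun ℂ).1 hspan
    refine ⟨c, fun A B => ?_⟩
    simpa [mul_comm] using (congrFun hc (A, B)).symm
  choose c hc using hentry
  refine BilinRankLE.of_quadratic l m (fun k => .of fun i j => c i j k) fun A B => ?_
  ext i j
  simpa [Matrix.sum_apply] using hc i j A B

/-! ### From bilinear rank to straight-line programs -/

theorem exists_forall_eq_trace_mul {R m n : Type*} [CommSemiring R] [Fintype m] [Fintype n]
    (l : Matrix m n R →ₗ[R] R) : ∃ C : Matrix n m R, ∀ A, l A = (C * A).trace := by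
  classical
  refine ⟨.of fun j i => l (.single i j 1), fun A => ?_⟩
  conv_lhs => rw [Matrix.matrix_eq_sum_single A]
  simp only [map_sum, Matrix.trace, Matrix.diag_apply, Matrix.mul_apply, Matrix.of_apply]
  rw [Finset.sum_comm]
  congr! 2 with j _ i
  rw [mul_comm, ← smul_eq_mul, ← map_smul, Matrix.smul_single, smul_eq_mul, mul_one]

/-- Once the functions in `S` are available, those in `T` can be made available by `s` further
field operations. -/
def ComputableFrom {X : Type} (S T : Set (X → ℂ)) (s : ℕ) : Prop :=
  ∀ (A : Set (X → ℂ)) (s₀ : ℕ) (S₀ : Set (X → ℂ)), ArithComputation A s₀ S₀ → S ⊆ S₀ →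
    ∃ S₁, S₀ ⊆ S₁ ∧ T ⊆ S₁ ∧ ArithComputation A (s₀ + s) S₁

/-- The entries of a matrix that depends on the input of a program. -/
def entries {X m n R : Type*} (a : X → Matrix m n R) : Set (X → R) :=
  Set.range fun (p : m × n) x => a x p.1 p.2

namespace ComputableFrom

variable {X : Type} {S T U : Set (X → ℂ)} {s t : ℕ}

theorem of_subset (h : T ⊆ S) : ComputableFrom S T 0 :=
  fun _ _ S₀ h₀ hS => ⟨S₀, subset_rfl, h.trans hS, h₀⟩

theorem mono {S' T' : Set (X → ℂ)} (h : ComputableFrom S T s) (hS : S ⊆ S') (hT : T' ⊆ T) :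
    ComputableFrom S' T' s := fun A s₀ S₀ h₀ hS₀ => by
  obtain ⟨S₁, hsub, hTS, h₁⟩ := h A s₀ S₀ h₀ (hS.trans hS₀)
  exact ⟨S₁, hsub, hT.trans hTS, h₁⟩

theorem trans (h : ComputableFrom S T s) (h' : ComputableFrom (S ∪ T) U t) :
    ComputableFrom S (T ∪ U) (s + t) := fun A s₀ S₀ h₀ hS₀ => by
  obtain ⟨S₁, hS₁, hT, h₁⟩ := h A s₀ S₀ h₀ hS₀
  obtain ⟨S₂, hS₂, hU, h₂⟩ := h' A _ S₁ h₁ (Set.union_subset (hS₀.trans hS₁) hT)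
  exact ⟨S₂, hS₁.trans hS₂, Set.union_subset (hT.trans hS₂) hU, by rwa [← add_assoc]⟩

theorem union (h : ComputableFrom S T s) (h' : ComputableFrom S U t) :
    ComputableFrom S (T ∪ U) (s + t) :=
  h.trans (h'.mono Set.subset_union_left subset_rfl)

theorem mul {f g : X → ℂ} (hf : f ∈ S) (hg : g ∈ S) :
    ComputableFrom S {fun x => f x * g x} 1 := fun _ _ _ h₀ h₁ =>
  ⟨_, Set.subset_insert _ _, by simp, .mul h₀ (h₁ hf) (h₁ hg)⟩

theorem add {f g : X → ℂ} (hf : f ∈ S) (hg : g ∈ S) :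
    ComputableFrom S {fun x => f x + g x} 1 := fun _ _ _ h₀ h₁ =>
  ⟨_, Set.subset_insert _ _, by simp, .add h₀ (h₁ hf) (h₁ hg)⟩

theorem biUnion {ι : Type*} (J : Finset ι) {T : ι → Set (X → ℂ)}
    (h : ∀ i, ComputableFrom S (T i) s) : ComputableFrom S (⋃ i ∈ J, T i) (J.card * s) := by
  classical
  induction J using Finset.induction_on with
  | empty => simpa using of_subset (Set.empty_subset _)
  | insert a J ha ih =>
    rw [Finset.card_insert_of_notMem ha, add_mul, one_mul, Finset.set_biUnion_insert,
      Set.union_comm]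
    exact ih.union (h a)

theorem iUnion {ι : Type*} [Fintype ι] {T : ι → Set (X → ℂ)}
    (h : ∀ i, ComputableFrom S (T i) s) : ComputableFrom S (⋃ i, T i) (Fintype.card ι * s) := by
  simpa using biUnion Finset.univ h

theorem range {ι : Type*} [Fintype ι] {f : ι → X → ℂ} (h : ∀ i, ComputableFrom S {f i} s) :
    ComputableFrom S (Set.range f) (Fintype.card ι * s) := by
  simpa using iUnion h

theorem sum_const_mul {ι : Type*} (J : Finset ι) (c : ι → ℂ) {f : ι → X → ℂ}
    (hc : ∀ c : ℂ, (fun _ => c) ∈ S) (hf : ∀ i, f i ∈ S) :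
    ComputableFrom S {fun x => ∑ i ∈ J, c i * f i x} (J.card * 2) := by
  classical
  induction J using Finset.induction_on with
  | empty => simpa using of_subset (Set.singleton_subset_iff.2 (hc 0))
  | insert a J ha ih =>
    rw [Finset.card_insert_of_notMem ha, add_mul, one_mul]
    have hterms := ih.union (mul (hc (c a)) (hf a))
    have hsum := hterms.trans (add (f := fun x => c a * f a x)
      (g := fun x => ∑ i ∈ J, c i * f i x) (by simp) (by simp))
    exact hsum.mono subset_rfl (by simp [Finset.sum_insert ha])

theorem linearForm {m n : Type*} [Fintype m] [Fintype n] {a : X → Matrix m n ℂ}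
    (l : Matrix m n ℂ →ₗ[ℂ] ℂ) (hc : ∀ c : ℂ, (fun _ => c) ∈ S) (ha : entries a ⊆ S) :
    ComputableFrom S {fun x => l (a x)} (Fintype.card m * Fintype.card n * 2) := by
  obtain ⟨C, hC⟩ := exists_forall_eq_trace_mul l
  have hl : ∀ A, l A = ∑ p : m × n, C p.2 p.1 * A p.1 p.2 := fun A => by
    rw [hC, Fintype.sum_prod_type_right]
    rfl
  simpa only [← hl, Finset.card_univ, Fintype.card_prod] using
    sum_const_mul Finset.univ (fun p => C p.2 p.1) hc fun p : m × n => ha ⟨p, rfl⟩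

end ComputableFrom

/-- Any two square matrices indexed by `ι` whose entries are available functions can be multiplied
by `s` field operations. -/
def MatMulComputable (ι : Type*) [Fintype ι] (s : ℕ) : Prop :=
  ∀ (X : Type) (S : Set (X → ℂ)) (a b : X → Matrix ι ι ℂ), (∀ c : ℂ, (fun _ => c) ∈ S) →
    entries a ⊆ S → entries b ⊆ S → ComputableFrom S (entries fun x => a x * b x) s

namespace MatMulComputable

theorem of_unique (ι : Type*) [Unique ι] : MatMulComputable ι 1 := by
  intro X S a b _ ha hb
  refine (ComputableFrom.mul (ha ⟨default, rfl⟩) (hb ⟨default, rfl⟩)).mono subset_rfl ?_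
  rintro _ ⟨p, rfl⟩
  rw [Subsingleton.elim p default]
  exact funext fun x => Matrix.mul_apply.trans (Fintype.sum_unique _)

theorem of_card_le {ι κ : Type*} [Fintype ι] [Fintype κ] {s : ℕ} (h : MatMulComputable κ s)
    (hcard : Fintype.card ι ≤ Fintype.card κ) : MatMulComputable ι s := by
  classical
  intro X S a b hc ha hb
  let δ := Fin (Fintype.card κ - Fintype.card ι)
  let e : κ ≃ ι ⊕ δ := Fintype.equivOfCardEq (by simp [δ, hcard])
  let pad (A : Matrix ι ι ℂ) : Matrix κ κ ℂ := (Matrix.fromBlocks A 0 0 0).submatrix e e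
  have pad_mul : ∀ A B, pad (A * B) = pad A * pad B := fun A B => by
    simp [pad, Matrix.submatrix_mul_equiv, Matrix.fromBlocks_multiply]
  have entries_pad : ∀ f : X → Matrix ι ι ℂ, entries f ⊆ S → entries (fun x => pad (f x)) ⊆ S := by
    rintro f hf _ ⟨⟨p, q⟩, rfl⟩
    rcases hp : e p with i | i <;> rcases hq : e q with j | j
    · simpa [pad, hp, hq] using hf ⟨(i, j), rfl⟩
    all_goals simpa [pad, hp, hq] using hc 0
  refine (h X S _ _ hc (entries_pad a ha) (entries_pad b hb)).mono subset_rfl ?_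
  rintro _ ⟨⟨i, j⟩, rfl⟩
  exact ⟨(e.symm (.inl i), e.symm (.inl j)), by simp [← pad_mul, pad]⟩

theorem canMultiplyIn {n s : ℕ} (h : MatMulComputable (Fin n) s) : CanMultiplyIn n s := by
  have hc : ∀ c : ℂ, (fun _ => c) ∈ matMulInputs n := fun c => Or.inr (Or.inr ⟨c, rfl⟩)
  have hfst : entries (Prod.fst : MatrixPair n → _) ⊆ matMulInputs n := by
    rintro _ ⟨⟨i, j⟩, rfl⟩
    exact Or.inl ⟨i, j, rfl⟩
  have hsnd : entries (Prod.snd : MatrixPair n → _) ⊆ matMulInputs n := by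
    rintro _ ⟨⟨i, j⟩, rfl⟩
    exact Or.inr (Or.inl ⟨i, j, rfl⟩)
  obtain ⟨S, -, hout, hS⟩ := h _ _ _ _ hc hfst hsnd _ _ _ .start subset_rfl
  exact ⟨S, by simpa using hS, fun i j => hout ⟨(i, j), rfl⟩⟩

end MatMulComputable

/-- Regard `A` as a matrix over `κ` whose entries are matrices over `ι`, and apply the linear form
`u` to each of these. -/
def blockForm {ι κ R : Type*} [Semiring R] (u : Matrix ι ι R →ₗ[R] R)
    (A : Matrix (ι × κ) (ι × κ) R) : Matrix κ κ R :=
  .of fun q q' => u (A.submatrix (·, q) (·, q'))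

theorem mul_apply_eq_sum_blockForm {ι κ R : Type*} [Fintype ι] [Fintype κ] [CommSemiring R]
    {r : ℕ} {u v : Fin r → Matrix ι ι R →ₗ[R] R} {w : Fin r → Matrix ι ι R}
    (huvw : ∀ A B, mulLinearMap R A B = ∑ k, (u k A * v k B) • w k)
    (A B : Matrix (ι × κ) (ι × κ) R) (i j : ι) (q q' : κ) :
    (A * B) (i, q) (j, q') =
      ∑ k, w k i j * (blockForm (u k) A * blockForm (v k) B) q q' := by
  calc (A * B) (i, q) (j, q')
      = ∑ z, mulLinearMap R (A.submatrix (·, q) (·, z)) (B.submatrix (·, z) (·, q')) i j := by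
        simp only [Matrix.mul_apply, Fintype.sum_prod_type_right, mulLinearMap_apply_apply,
          Matrix.submatrix_apply]
    _ = ∑ k, w k i j * (blockForm (u k) A * blockForm (v k) B) q q' := by
        simp only [huvw, Matrix.sum_apply, Matrix.smul_apply, smul_eq_mul, Matrix.mul_apply,
          blockForm, Matrix.of_apply, Finset.mul_sum]
        rw [Finset.sum_comm]
        simp only [mul_comm]

theorem ComputableFrom.blockForm {X : Type} {S : Set (X → ℂ)} {ι κ : Type*} [Fintype ι]
    [Fintype κ] (u : Matrix ι ι ℂ →ₗ[ℂ] ℂ) {a : X → Matrix (ι × κ) (ι × κ) ℂ}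
    (hc : ∀ c : ℂ, (fun _ => c) ∈ S) (ha : entries a ⊆ S) :
    ComputableFrom S (entries fun x => blockForm u (a x))
      (Fintype.card (κ × κ) * (Fintype.card ι * Fintype.card ι * 2)) :=
  .range fun q => .linearForm (a := fun x => (a x).submatrix (·, q.1) (·, q.2)) u hc <| by
    rintro _ ⟨p, rfl⟩
    exact ha ⟨((p.1, q.1), (p.2, q.2)), rfl⟩

theorem MatMulRankLE.matMulComputable_prod {ι κ : Type*} [Fintype ι] [Fintype κ] {r t : ℕ}
    (h : MatMulRankLE ℂ ι ι ι r) (hκ : MatMulComputable κ t) :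
    MatMulComputable (ι × κ) (r * t + 6 * r * Fintype.card ι ^ 2 * Fintype.card κ ^ 2) := by
  obtain ⟨u, v, w, huvw⟩ := h
  intro X S a b hc ha hb
  have hforms := (ComputableFrom.iUnion fun k => .blockForm (u k) hc ha).union
    (ComputableFrom.iUnion fun k => .blockForm (v k) hc hb)
  have hproducts := hforms.trans <| ComputableFrom.iUnion fun k =>
    hκ X _ (fun x => blockForm (u k) (a x)) (fun x => blockForm (v k) (b x))
      (fun c => .inl (hc c)) (fun _ hf => .inr (.inl (Set.mem_iUnion.2 ⟨k, hf⟩)))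
      fun _ hf => .inr (.inr (Set.mem_iUnion.2 ⟨k, hf⟩))
  have houtput := hproducts.trans <| ComputableFrom.range
    (f := fun (p : (ι × κ) × (ι × κ)) x => ∑ k, w k p.1.1 p.2.1 *
      (blockForm (u k) (a x) * blockForm (v k) (b x)) p.1.2 p.2.2)
    fun p => .sum_const_mul Finset.univ _ (fun c => .inl (hc c))
      fun k => .inr (.inr (Set.mem_iUnion.2 ⟨k, (p.1.2, p.2.2), rfl⟩))
  convert houtput.mono subset_rfl Set.subset_union_right using 1
  · simp only [entries, mul_apply_eq_sum_blockForm huvw]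
  · simp only [Fintype.card_prod, Fintype.card_fin, Finset.card_univ]
    ring

theorem MatMulRankLE.exists_matMulComputable_pow {N r : ℕ} {ρ : ℝ}
    (h : MatMulRankLE ℂ (Fin N) (Fin N) (Fin N) r) (hr : r < ρ) (hN : (N : ℝ) ^ 2 ≤ ρ) :
    ∃ D : ℝ, 0 ≤ D ∧ ∀ l : ℕ, ∃ s : ℕ, (s : ℝ) ≤ D * ρ ^ l ∧ MatMulComputable (Fin (N ^ l)) s := by
  have hρ : 0 ≤ ρ := (sq_nonneg _).trans hN
  obtain ⟨D, hD, hstep⟩ : ∃ D : ℝ, 1 ≤ D ∧ r * D + 6 * r * N ^ 2 ≤ ρ * D := by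
    have hgap : 0 < ρ - r := sub_pos.2 hr
    refine ⟨1 + 6 * r * N ^ 2 / (ρ - r), by simp only [le_add_iff_nonneg_right]; positivity, ?_⟩
    linarith [div_mul_cancel₀ (6 * r * N ^ 2 : ℝ) hgap.ne']
  refine ⟨D, by linarith, fun l => ?_⟩
  induction l with
  | zero => exact ⟨1, by simpa using hD, (MatMulComputable.of_unique Unit).of_card_le (by simp)⟩
  | succ l ih =>
    obtain ⟨s, hs, hmul⟩ := ih
    refine ⟨_, ?_, (h.matMulComputable_prod hmul).of_card_le (by simp [pow_succ'])⟩
    simp only [Fintype.card_fin]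
    push_cast
    calc r * s + 6 * r * N ^ 2 * ((N : ℝ) ^ l) ^ 2
        = r * s + 6 * r * N ^ 2 * ((N : ℝ) ^ 2) ^ l := by rw [pow_right_comm]
      _ ≤ r * (D * ρ ^ l) + 6 * r * N ^ 2 * ρ ^ l := by gcongr
      _ = (r * D + 6 * r * N ^ 2) * ρ ^ l := by ring
      _ ≤ ρ * D * ρ ^ l := by gcongr
      _ = D * ρ ^ (l + 1) := by ring

theorem MatMulRankLE.mem_matMulExponents {N r : ℕ} {τ : ℝ} (hN : 2 ≤ N)
    (h : MatMulRankLE ℂ (Fin N) (Fin N) (Fin N) r) (hr : r < (N : ℝ) ^ τ) :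
    τ ∈ matMulExponents := by
  have : NeZero N := ⟨by omega⟩
  have hNr : N ^ 2 ≤ r := by simpa [sq] using h.card_mul_card_le
  have hN1 : (1 : ℝ) < N := by exact_mod_cast hN
  have hr1 : (1 : ℝ) ≤ r := by exact_mod_cast (Nat.one_le_pow 2 N (by omega)).trans hNr
  have hτ : 0 ≤ τ := by
    by_contra! hneg
    exact (Real.rpow_lt_one_of_one_lt_of_neg hN1 hneg).not_ge (hr1.trans hr.le)
  obtain ⟨D, hD, hcomp⟩ := h.exists_matMulComputable_pow hr
    (le_trans (by exact_mod_cast hNr) hr.le)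
  refine ⟨D * (N : ℝ) ^ τ, fun n hn => ?_⟩
  obtain ⟨s, hs, hmul⟩ := hcomp (Nat.clog N n)
  refine ⟨s, ?_, (hmul.of_card_le (by simpa using Nat.le_pow_clog hN n)).canMultiplyIn⟩
  have hclog : N ^ Nat.clog N n ≤ N * n := by
    rcases hn.eq_or_lt with rfl | hn
    · simpa using (by omega : 1 ≤ N)
    · rw [← Nat.succ_pred_eq_of_pos (Nat.clog_pos hN hn), pow_succ']
      exact Nat.mul_le_mul_left N (Nat.pow_pred_clog_lt_self hN hn).le
  calc (s : ℝ) ≤ D * ((N : ℝ) ^ τ) ^ Nat.clog N n := hs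
    _ = D * ((N : ℝ) ^ Nat.clog N n) ^ τ := by rw [Real.rpow_pow_comm (by positivity)]
    _ ≤ D * (N * n : ℝ) ^ τ := by gcongr; exact_mod_cast hclog
    _ = D * (N : ℝ) ^ τ * (n : ℝ) ^ τ := by
      rw [Real.mul_rpow (by positivity) (by positivity), mul_assoc]

theorem MatMulRankLE.rpow_matMulExponent_le {κ : Type*} [Fintype κ] [Nonempty κ] {r : ℕ}
    (h : MatMulRankLE ℂ κ κ κ r) : (Fintype.card κ : ℝ) ^ matMulExponent ≤ r := by
  let e := (Fintype.equivFin κ).symm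
  have hN : 1 ≤ Fintype.card κ := Fintype.card_pos
  have hr : 1 ≤ r := (Nat.mul_pos hN hN).trans_le h.card_mul_card_le
  have hr0 : (0 : ℝ) < r := by exact_mod_cast hr
  by_contra! hlt
  rcases hN.eq_or_lt with h1 | h2
  · rw [← h1, Nat.cast_one, Real.one_rpow, Nat.cast_lt_one] at hlt
    omega
  · have h2' : (1 : ℝ) < Fintype.card κ := by exact_mod_cast h2
    obtain ⟨τ, hτ, hτω⟩ := exists_between ((Real.logb_lt_iff_lt_rpow h2' hr0).2 hlt)
    exact hτω.not_ge (csInf_le bddBelow_matMulExponents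
      ((h.congr e e e).mem_matMulExponents h2 ((Real.logb_lt_iff_lt_rpow h2' hr0).1 hτ)))

theorem le_of_forall_pow_le_mul_pow {K : Type*} [Field K] [LinearOrder K] [IsStrictOrderedRing K]
    [Archimedean K] {a b C : K} (hb : 0 ≤ b) (h : ∀ l : ℕ, a ^ l ≤ C * b ^ l) :
    a ≤ b := by
  by_contra! hab
  rcases hb.eq_or_lt with rfl | hb
  · exact hab.not_ge (by simpa using h 1)
  · obtain ⟨l, hl⟩ := pow_unbounded_of_one_lt C ((one_lt_div hb).2 hab)
    rw [div_pow, lt_div_iff₀ (by positivity)] at hl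
    exact hl.not_ge (h l)

theorem exists_matMulRankLE_of_mem_matMulExponents {τ : ℝ} (hτ : τ ∈ matMulExponents) :
    ∃ C : ℝ, ∀ n : ℕ, 1 ≤ n → ∃ r : ℕ, (r : ℝ) ≤ C * (n : ℝ) ^ τ ∧
      MatMulRankLE ℂ (Fin n) (Fin n) (Fin n) r := by
  obtain ⟨C, hC⟩ := hτ
  refine ⟨2 * C, fun n hn => ?_⟩
  obtain ⟨s, hs, hmul⟩ := hC n hn
  exact ⟨2 * s, by push_cast; linarith, hmul.matMulRankLE⟩

theorem two_le_matMulExponent : 2 ≤ matMulExponent := by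
  refine le_csInf ⟨3, three_mem_matMulExponents⟩ fun τ hτ => ?_
  obtain ⟨C, hC⟩ := exists_matMulRankLE_of_mem_matMulExponents hτ
  have hpow : ∀ l : ℕ, ((2 : ℝ) ^ (2 : ℝ)) ^ l ≤ C * ((2 : ℝ) ^ τ) ^ l := fun l => by
    obtain ⟨r, hr, hrank⟩ := hC (2 ^ l) Nat.one_le_two_pow
    have hle : ((2 : ℝ) ^ l) ^ 2 ≤ r := by
      exact_mod_cast (by simpa [sq] using hrank.card_mul_card_le : (2 ^ l) ^ 2 ≤ r)
    rw [Real.rpow_pow_comm zero_le_two, Real.rpow_pow_comm zero_le_two, Real.rpow_two]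
    exact hle.trans (by exact_mod_cast hr)
  exact (Real.rpow_le_rpow_left_iff one_lt_two).1
    (le_of_forall_pow_le_mul_pow (by positivity) hpow)

/-! ### Detecting the identity of a group by matrix representations -/

section DetectsOne

variable {R G J ι : Type*} {κ : ι → Type*} [CommSemiring R]

section KroneckerPi

variable {κ : J → Type*} [Fintype J] [DecidableEq J] [∀ j, Fintype (κ j)] [∀ j, DecidableEq (κ j)]

/-- The Kronecker product of a finite family of square matrices, as a homomorphism. -/
def kroneckerPi : (∀ j, Matrix (κ j) (κ j) R) →* Matrix (∀ j, κ j) (∀ j, κ j) R where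
  toFun A := Matrix.of fun a b => ∏ j, A j (a j) (b j)
  map_one' := by
    ext a b
    simp only [Pi.one_apply, Matrix.one_apply, Matrix.of_apply, Fintype.prod_ite_zero,
      Finset.prod_const_one, funext_iff]
  map_mul' A B := by
    ext a b
    simp only [Matrix.mul_apply, Matrix.of_apply, Pi.mul_apply, Finset.prod_univ_sum,
      Fintype.piFinset_univ, Finset.prod_mul_distrib]

theorem trace_kroneckerPi (A : ∀ j, Matrix (κ j) (κ j) R) :
    (kroneckerPi A).trace = ∏ j, (A j).trace := by
  simp only [Matrix.trace, Finset.prod_univ_sum, Fintype.piFinset_univ]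
  rfl

end KroneckerPi

variable [Group G] [Fintype ι] [∀ i, Fintype (κ i)] [∀ i, DecidableEq (κ i)]

open Classical in
/-- Some linear combination of the entries of the matrix representations `ρ i` is the indicator
function of `1 : G`; over a commutative ring this says that together they embed the group algebra
as a direct summand. -/
def DetectsOne (ρ : ∀ i, G →* Matrix (κ i) (κ i) R) : Prop :=
  ∃ c : ∀ i, Matrix (κ i) (κ i) R, ∀ g, ∑ i, (c i * ρ i g).trace = if g = 1 then 1 else 0

namespace DetectsOne

variable {ρ : ∀ i, G →* Matrix (κ i) (κ i) R}

theorem pi (h : DetectsOne ρ) (J : Type*) [Fintype J] [DecidableEq J] :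
    DetectsOne fun I : J → ι =>
      kroneckerPi.comp
        (MonoidHom.pi fun j => (ρ (I j)).comp (Pi.evalMonoidHom (fun _ => G) j)) := by
  classical
  obtain ⟨c, hc⟩ := h
  refine ⟨fun I => kroneckerPi fun j => c (I j), fun g => ?_⟩
  calc ∑ I : J → ι, (kroneckerPi (fun j => c (I j)) * kroneckerPi fun j => ρ (I j) (g j)).trace
      = ∑ I : J → ι, ∏ j, (c (I j) * ρ (I j) (g j)).trace := by
        simp only [← map_mul, trace_kroneckerPi, Pi.mul_apply]
    _ = ∏ j, ∑ i, (c i * ρ i (g j)).trace := by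
        rw [Finset.prod_univ_sum, Fintype.piFinset_univ]
    _ = _ := by
        simp only [hc, Fintype.prod_ite_zero, Finset.prod_const_one, funext_iff, Pi.one_apply]

/-- Fourier inversion: the coefficient of `z` at `g` is found by detecting `1` in `z * g⁻¹`. -/
theorem exists_sum_lift_eq [Finite G] (h : DetectsOne ρ) :
    ∃ k : ∀ i, Matrix (κ i) (κ i) R →ₗ[R] MonoidAlgebra R G,
      ∀ z, ∑ i, k i (MonoidAlgebra.lift R (Matrix (κ i) (κ i) R) G (ρ i) z) = z := by
  classical
  obtain ⟨c, hc⟩ := h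
  have := Fintype.ofFinite G
  let k i : Matrix (κ i) (κ i) R →ₗ[R] MonoidAlgebra R G :=
    ∑ g : G, MonoidAlgebra.lsingle g ∘ₗ Matrix.traceLinearMap (κ i) R R ∘ₗ
      LinearMap.mulLeft R (c i) ∘ₗ LinearMap.mulRight R (ρ i g⁻¹)
  have hk : ∀ h, ∑ i, k i (ρ i h) = MonoidAlgebra.single h 1 := by
    intro h
    ext x
    calc (∑ i, k i (ρ i h)).coeff x = ∑ i, (c i * ρ i (h * x⁻¹)).trace := by
          simp [k, Finsupp.single_apply]
      _ = (MonoidAlgebra.single h 1).coeff x := by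
          simp only [hc, mul_inv_eq_one, MonoidAlgebra.coeff_single, Finsupp.single_apply]
  refine ⟨k, fun z => ?_⟩
  induction z using MonoidAlgebra.induction_on with
  | of g => simpa using hk g
  | add x y hx hy => simp only [map_add, Finset.sum_add_distrib, hx, hy]
  | smul a x hx => simp only [map_smul, ← Finset.smul_sum, hx]

theorem bilinRankLE_mul [Finite G] (h : DetectsOne ρ) {r : ι → ℕ}
    (hr : ∀ i, MatMulRankLE R (κ i) (κ i) (κ i) (r i)) :
    BilinRankLE (LinearMap.mul R (MonoidAlgebra R G)) (∑ i, r i) := by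
  obtain ⟨k, hk⟩ := h.exists_sum_lift_eq
  have hmul : LinearMap.mul R (MonoidAlgebra R G) = ∑ i, ((mulLinearMap R).compl₁₂
      (MonoidAlgebra.lift R (Matrix (κ i) (κ i) R) G (ρ i)).toLinearMap
      (MonoidAlgebra.lift R (Matrix (κ i) (κ i) R) G (ρ i)).toLinearMap).compr₂ (k i) := by
    refine LinearMap.ext₂ fun x y => ?_
    simp [← map_mul, hk]
  rw [hmul]
  exact BilinRankLE.sum fun i => (hr i).comp _ _ (k i) fun _ _ => rfl

end DetectsOne

end DetectsOne

/-! ### Triples with the triple product property -/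

section TripleProductProperty

variable {G : Type*} [Group G]

open Classical in
/-- The embedding of `S × T` matrices into the group algebra through which Cohn and Umans reduce
matrix multiplication to multiplication in the group algebra: the `(s, t)` entry becomes the
coefficient of `s⁻¹ * t`. -/
noncomputable def groupAlgebraEmbedding (R : Type*) [CommSemiring R] (S T : Finset G) :
    Matrix S T R →ₗ[R] MonoidAlgebra R G :=
  ∑ s : S, ∑ t : T, MonoidAlgebra.lsingle ((s : G)⁻¹ * t) ∘ₗ Matrix.entryLinearMap R R s t

namespace TripleProductProperty

variable {S₁ S₂ S₃ : Finset G}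

theorem inv_mul_mul_inv_mul_eq_iff (h : TripleProductProperty S₁ S₂ S₃) {s s' : S₁} {t t' : S₂}
    {u u' : S₃} : (s' : G)⁻¹ * t * ((t' : G)⁻¹ * u') = (s : G)⁻¹ * u ↔
      s' = s ∧ t' = t ∧ u' = u := by
  constructor
  · intro heq
    obtain ⟨hs, ht, hu⟩ := h (s * (s' : G)⁻¹) ⟨s, s.2, s', s'.2, rfl⟩ (t * (t' : G)⁻¹)
      ⟨t, t.2, t', t'.2, rfl⟩ (u' * (u : G)⁻¹) ⟨u', u'.2, u, u.2, rfl⟩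
      (calc _ = (s : G) * ((s' : G)⁻¹ * t * ((t' : G)⁻¹ * u')) * (u : G)⁻¹ := by group
        _ = 1 := by rw [heq]; group)
    simp only [mul_inv_eq_one, SetLike.coe_eq_coe] at hs ht hu
    exact ⟨hs.symm, ht.symm, hu⟩
  · rintro ⟨rfl, rfl, rfl⟩
    group

theorem coeff_groupAlgebraEmbedding_mul (h : TripleProductProperty S₁ S₂ S₃) {R : Type*}
    [CommSemiring R] (A : Matrix S₁ S₂ R) (B : Matrix S₂ S₃ R) (s : S₁) (u : S₃) :
    (groupAlgebraEmbedding R S₁ S₂ A * groupAlgebraEmbedding R S₂ S₃ B).coeff ((s : G)⁻¹ * u) =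
      (A * B) s u := by
  classical
  calc _ = ∑ s', ∑ t', ∑ t, ∑ u', if s' = s ∧ t' = t ∧ u' = u then A s' t * B t' u' else 0 := by
        simp only [groupAlgebraEmbedding, LinearMap.sum_apply, LinearMap.comp_apply,
          MonoidAlgebra.lsingle_apply, Matrix.entryLinearMap_apply, Finset.sum_mul_sum,
          MonoidAlgebra.single_mul_single, MonoidAlgebra.coeff_sum, Finsupp.finsetSum_apply,
          MonoidAlgebra.coeff_single, Finsupp.single_apply, h.inv_mul_mul_inv_mul_eq_iff]
    _ = ∑ t, A s t * B t u := by
        simp [ite_and]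
    _ = (A * B) s u := (Matrix.mul_apply ..).symm

theorem matMulRankLE (h : TripleProductProperty S₁ S₂ S₃) {R : Type*} [CommSemiring R] {r : ℕ}
    (hr : BilinRankLE (LinearMap.mul R (MonoidAlgebra R G)) r) : MatMulRankLE R S₁ S₂ S₃ r := by
  let entries : MonoidAlgebra R G →ₗ[R] Matrix S₁ S₃ R :=
    { toFun z := Matrix.of fun s u => z.coeff ((s : G)⁻¹ * u)
      map_add' _ _ := rfl
      map_smul' _ _ := rfl }
  refine hr.comp (groupAlgebraEmbedding R S₁ S₂) (groupAlgebraEmbedding R S₂ S₃) entries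
    fun A B => ?_
  ext s u
  exact (h.coeff_groupAlgebraEmbedding_mul A B s u).symm

theorem rotate (h : TripleProductProperty S₁ S₂ S₃) : TripleProductProperty S₂ S₃ S₁ := by
  intro q₁ h₁ q₂ h₂ q₃ h₃ hq
  obtain ⟨hq₃, hq₁, hq₂⟩ := h q₃ h₃ q₁ h₁ q₂ h₂ (by rwa [mul_assoc, mul_eq_one_comm])
  exact ⟨hq₁, hq₂, hq₃⟩

theorem pi {J : Type*} [Fintype J] [DecidableEq J] {G : J → Type*} [∀ j, Group (G j)]
    {S₁ S₂ S₃ : ∀ j, Finset (G j)} (h : ∀ j, TripleProductProperty (S₁ j) (S₂ j) (S₃ j)) :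
    TripleProductProperty (Fintype.piFinset S₁) (Fintype.piFinset S₂) (Fintype.piFinset S₃) := by
  have proj : ∀ {S : ∀ j, Finset (G j)} {q : ∀ j, G j},
      q ∈ rightQuotientSet (Fintype.piFinset S) → ∀ j, q j ∈ rightQuotientSet (S j) := by
    rintro S _ ⟨a, ha, b, hb, rfl⟩ j
    exact ⟨a j, Fintype.mem_piFinset.1 ha j, b j, Fintype.mem_piFinset.1 hb j, rfl⟩
  intro q₁ h₁ q₂ h₂ q₃ h₃ hq
  have hj j := h j _ (proj h₁ j) _ (proj h₂ j) _ (proj h₃ j) (congrFun hq j)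
  exact ⟨funext fun j => (hj j).1, funext fun j => (hj j).2.1, funext fun j => (hj j).2.2⟩

end TripleProductProperty

namespace Realizes

theorem rotate {n m p : ℕ} (h : Realizes G n m p) : Realizes G m p n := by
  obtain ⟨S₁, S₂, S₃, h₁, h₂, h₃, h⟩ := h
  exact ⟨S₂, S₃, S₁, h₂, h₃, h₁, h.rotate⟩

theorem pi {J : Type*} [Fintype J] {G : J → Type*} [∀ j, Group (G j)] {n m p : J → ℕ}
    (h : ∀ j, Realizes (G j) (n j) (m j) (p j)) :
    Realizes (∀ j, G j) (∏ j, n j) (∏ j, m j) (∏ j, p j) := by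
  classical
  choose S₁ S₂ S₃ h₁ h₂ h₃ h using h
  exact ⟨_, _, _, by simp [h₁], by simp [h₂], by simp [h₃], .pi h⟩

/-- The three cyclic rotations of a triple, combined in `G × G × G`. -/
theorem cube {n m p : ℕ} (h : Realizes G n m p) :
    Realizes (Fin 3 → G) (n * m * p) (n * m * p) (n * m * p) := by
  have := pi (n := ![n, m, p]) (m := ![m, p, n]) (p := ![p, n, m]) (G := fun _ => G) fun j => by
    fin_cases j
    exacts [h, h.rotate, h.rotate.rotate]
  convert this using 1 <;> simp [Fin.prod_univ_three] <;> ring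

theorem matMulRankLE {n m p : ℕ} (h : Realizes G n m p) {R : Type*} [CommSemiring R] {r : ℕ}
    (hr : BilinRankLE (LinearMap.mul R (MonoidAlgebra R G)) r) :
    MatMulRankLE R (Fin n) (Fin m) (Fin p) r := by
  obtain ⟨S₁, S₂, S₃, rfl, rfl, rfl, h⟩ := h
  exact (h.matMulRankLE hr).congr S₁.equivFin.symm S₂.equivFin.symm S₃.equivFin.symm

end Realizes

end TripleProductProperty

/-! ### The exponent bound -/

theorem sum_card_pi_rpow {ι : Type*} [Fintype ι] {κ : ι → Type*} [∀ i, Fintype (κ i)] (l : ℕ)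
    (τ : ℝ) : ∑ I : Fin l → ι, (Fintype.card (∀ j, κ (I j)) : ℝ) ^ τ =
      (∑ i, (Fintype.card (κ i) : ℝ) ^ τ) ^ l := by
  simp [Fintype.sum_pow, Real.finsetProd_rpow]

namespace Realizes

variable {G ι : Type*} [Group G] [Finite G] [Fintype ι] {κ : ι → Type*} [∀ i, Fintype (κ i)]
  [∀ i, DecidableEq (κ i)] {ρ : ∀ i, G →* Matrix (κ i) (κ i) ℂ}

theorem rpow_matMulExponent_le_sum_rank {N : ℕ} [NeZero N] (h : Realizes G N N N)
    (hρ : DetectsOne ρ) {r : ι → ℕ} (hr : ∀ i, MatMulRankLE ℂ (κ i) (κ i) (κ i) (r i)) :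
    (N : ℝ) ^ matMulExponent ≤ ∑ i, (r i : ℝ) := by
  simpa using (h.matMulRankLE (hρ.bilinRankLE_mul hr)).rpow_matMulExponent_le

variable [∀ i, Nonempty (κ i)]

/-- The constant in the bound on the ranks disappears in the limit of high powers of `G`. -/
theorem rpow_matMulExponent_le_sum_rpow_of_mem {N : ℕ} [NeZero N] (h : Realizes G N N N)
    (hρ : DetectsOne ρ) {τ : ℝ} (hτ : τ ∈ matMulExponents) :
    (N : ℝ) ^ matMulExponent ≤ ∑ i, (Fintype.card (κ i) : ℝ) ^ τ := by
  obtain ⟨C, hC⟩ := exists_matMulRankLE_of_mem_matMulExponents hτ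
  refine le_of_forall_pow_le_mul_pow (C := C) (by positivity) fun l => ?_
  choose r hr hrank using fun I : Fin l → ι =>
    hC (Fintype.card (∀ j, κ (I j))) Fintype.card_pos
  have hpow : Realizes (Fin l → G) (N ^ l) (N ^ l) (N ^ l) := by
    simpa using pi fun _ : Fin l => h
  calc ((N : ℝ) ^ matMulExponent) ^ l = ((N ^ l : ℕ) : ℝ) ^ matMulExponent := by
        rw [Nat.cast_pow, Real.rpow_pow_comm N.cast_nonneg]
    _ ≤ ∑ I, (r I : ℝ) := hpow.rpow_matMulExponent_le_sum_rank (hρ.pi (Fin l)) fun I =>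
        (hrank I).congr (Fintype.equivFin _) (Fintype.equivFin _) (Fintype.equivFin _)
    _ ≤ ∑ I : Fin l → ι, C * (Fintype.card (∀ j, κ (I j)) : ℝ) ^ τ :=
        Finset.sum_le_sum fun I _ => hr I
    _ = C * (∑ i, (Fintype.card (κ i) : ℝ) ^ τ) ^ l := by
        rw [← Finset.mul_sum, sum_card_pi_rpow]

theorem rpow_matMulExponent_le_sum_rpow {N : ℕ} [NeZero N] (h : Realizes G N N N)
    (hρ : DetectsOne ρ) :
    (N : ℝ) ^ matMulExponent ≤ ∑ i, (Fintype.card (κ i) : ℝ) ^ matMulExponent := by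
  have hclosed : IsClosed {τ : ℝ | (N : ℝ) ^ matMulExponent ≤ ∑ i, (Fintype.card (κ i) : ℝ) ^ τ} :=
    isClosed_le continuous_const <| continuous_finsetSum _ fun i _ =>
      Real.continuous_const_rpow (by simp)
  exact closure_minimal (fun τ hτ => h.rpow_matMulExponent_le_sum_rpow_of_mem hρ hτ) hclosed
    (csInf_mem_closure ⟨3, three_mem_matMulExponents⟩ bddBelow_matMulExponents)

theorem rpow_matMulExponent_le_sum_rpow_pow_three {n m p : ℕ} [NeZero (n * m * p)]
    (h : Realizes G n m p) (hρ : DetectsOne ρ) :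
    ((n * m * p : ℕ) : ℝ) ^ matMulExponent ≤
      (∑ i, (Fintype.card (κ i) : ℝ) ^ matMulExponent) ^ 3 := by
  rw [← sum_card_pi_rpow]
  exact h.cube.rpow_matMulExponent_le_sum_rpow (hρ.pi (Fin 3))

end Realizes

/-! ### Wedderburn decomposition of the group algebra -/

theorem isIrreducible_of_surjective_asAlgebraHom {k G V : Type*} [Field k] [Monoid G]
    [AddCommGroup V] [Module k V] [Nontrivial V] {ρ : Representation k G V}
    (hρ : Function.Surjective ρ.asAlgebraHom) : ρ.IsIrreducible := by
  have : RingHomSurjective (ρ.asAlgebraHom : MonoidAlgebra k G →+* Module.End k V) := ⟨hρ⟩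
  let l : ρ.asModule →ₛₗ[(ρ.asAlgebraHom : MonoidAlgebra k G →+* Module.End k V)] V :=
    { ρ.asModuleEquiv with map_smul' := ρ.asModuleEquiv_map_smul }
  exact ρ.irreducible_iff_isSimpleModule_asModule.2 <|
    (l.isSimpleModule_iff_of_bijective ρ.asModuleEquiv.bijective).2 inferInstance

theorem mem_characterDegrees_of_surjective {G : Type*} [Group G] {d : ℕ} [NeZero d]
    {f : MonoidAlgebra ℂ G →ₐ[ℂ] Matrix (Fin d) (Fin d) ℂ} (hf : Function.Surjective f) :
    d ∈ characterDegrees G := by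
  let F := (Matrix.toLinAlgEquiv' : _ ≃ₐ[ℂ] Module.End ℂ (Fin d → ℂ)).toAlgHom.comp f
  let ρ : Representation ℂ G (Fin d → ℂ) := (MonoidAlgebra.lift ℂ _ G).symm F
  have hρ : ρ.asAlgebraHom = F := (MonoidAlgebra.lift ℂ _ G).apply_symm_apply F
  refine ⟨ρ, isIrreducible_of_surjective_asAlgebraHom ?_⟩
  rw [hρ]
  exact Matrix.toLinAlgEquiv'.surjective.comp hf

section BlockRep

variable {R G ι : Type*} {κ : ι → Type*} [CommSemiring R] [Monoid G] [∀ i, Fintype (κ i)]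
  [∀ i, DecidableEq (κ i)]

/-- The matrix representation of `G` on the `i`-th factor of a decomposition of its group algebra
into matrix algebras. -/
noncomputable def blockRep (e : MonoidAlgebra R G ≃ₐ[R] ∀ i, Matrix (κ i) (κ i) R) (i : ι) :
    G →* Matrix (κ i) (κ i) R :=
  (((Pi.evalAlgHom R _ i).comp e.toAlgHom : MonoidAlgebra R G →ₐ[R] _) : _ →* _).comp
    (MonoidAlgebra.of R G)

theorem detectsOne_blockRep {G : Type*} [Group G] [Fintype ι]
    (e : MonoidAlgebra R G ≃ₐ[R] ∀ i, Matrix (κ i) (κ i) R) : DetectsOne (blockRep e) := by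
  classical
  let coeffOne : (∀ i, Matrix (κ i) (κ i) R) →ₗ[R] R :=
    Finsupp.lapply 1 ∘ₗ (MonoidAlgebra.coeffLinearEquiv R).toLinearMap ∘ₗ e.symm.toLinearMap
  choose c hc using fun i =>
    exists_forall_eq_trace_mul (coeffOne ∘ₗ LinearMap.single R (fun i => Matrix (κ i) (κ i) R) i)
  refine ⟨c, fun g => ?_⟩
  calc ∑ i, (c i * blockRep e i g).trace
      = ∑ i, coeffOne (Pi.single i (e (MonoidAlgebra.of R G g) i)) :=
        Finset.sum_congr rfl fun i _ => (hc i _).symm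
    _ = coeffOne (e (MonoidAlgebra.of R G g)) := by rw [← map_sum, Finset.univ_sum_single]
    _ = _ := by simp [coeffOne, Finsupp.single_apply]

theorem sum_sq_card_eq_card {R : Type*} [CommRing R] [Nontrivial R] [Finite G] [Fintype ι]
    (e : MonoidAlgebra R G ≃ₐ[R] ∀ i, Matrix (κ i) (κ i) R) :
    ∑ i, Fintype.card (κ i) ^ 2 = Nat.card G := by
  have := Fintype.ofFinite G
  have h := e.toLinearEquiv.finrank_eq
  rw [(MonoidAlgebra.coeffLinearEquiv (M := G) (S := R) R).finrank_eq,
    Module.finrank_finsupp_self, Module.finrank_pi_fintype] at h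
  simp only [Module.finrank_matrix, Module.finrank_self, mul_one] at h
  simp only [sq, ← h, Nat.card_eq_fintype_card]

end BlockRep

theorem exists_detectsOne (G : Type*) [Group G] [Finite G] :
    ∃ (k : ℕ) (d : Fin k → ℕ) (ρ : ∀ i, G →* Matrix (Fin (d i)) (Fin (d i)) ℂ),
      (∀ i, d i ≠ 0) ∧ (∀ i, d i ∈ characterDegrees G) ∧ ∑ i, d i ^ 2 = Nat.card G ∧
        DetectsOne ρ := by
  have : NeZero (Nat.card G : ℂ) := ⟨Nat.cast_ne_zero.2 Nat.card_pos.ne'⟩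
  obtain ⟨k, d, hd, ⟨e⟩⟩ :=
    IsSemisimpleRing.exists_algEquiv_pi_matrix_of_isAlgClosed ℂ (MonoidAlgebra ℂ G)
  refine ⟨k, d, blockRep e, fun i => NeZero.ne _, fun i => ?_, ?_, detectsOne_blockRep e⟩
  · exact mem_characterDegrees_of_surjective (f := (Pi.evalAlgHom ℂ _ i).comp e.toAlgHom)
      ((Function.surjective_eval i).comp e.surjective)
  · simpa using sum_sq_card_eq_card e

/-! ### Largest character degree and pseudo-exponent -/

theorem maxCharacterDegree_pos (G : Type*) [Group G] [Finite G] : 0 < maxCharacterDegree G :=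
  le_csSup (bddAbove_characterDegrees G) (one_mem_characterDegrees G)

theorem maxCharacterDegree_eq_one (G : Type*) [Group G] [IsMulCommutative G] :
    maxCharacterDegree G = 1 := by
  refine IsGreatest.csSup_eq ⟨one_mem_characterDegrees G, ?_⟩
  rintro d ⟨ρ, hρ⟩
  simpa using hρ.finrank_eq_one_of_isMulCommutative.le

theorem sum_rpow_le_rpow_mul_sum_sq {ι : Type*} [Fintype ι] {d : ι → ℝ} {D τ : ℝ} (hτ : 2 ≤ τ)
    (hd : ∀ i, 0 ≤ d i) (hD : ∀ i, d i ≤ D) :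
    ∑ i, d i ^ τ ≤ D ^ (τ - 2) * ∑ i, d i ^ 2 := by
  rw [Finset.mul_sum]
  refine Finset.sum_le_sum fun i _ => ?_
  calc d i ^ τ = d i ^ (τ - 2) * d i ^ 2 := by
        rw [← Real.rpow_natCast, ← Real.rpow_add_of_nonneg (hd i) (by linarith) (by norm_num)]
        norm_num
    _ ≤ D ^ (τ - 2) * d i ^ 2 := by
        gcongr
        exacts [hd i, hD i]

theorem Realizes.rpow_matMulExponent_le {G : Type*} [Group G] [Finite G] {n m p : ℕ}
    [NeZero (n * m * p)] (h : Realizes G n m p) :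
    ((n * m * p : ℕ) : ℝ) ^ matMulExponent ≤
      ((maxCharacterDegree G : ℝ) ^ (matMulExponent - 2) * Nat.card G) ^ 3 := by
  obtain ⟨k, d, ρ, hd, hchar, hsq, hρ⟩ := exists_detectsOne G
  have : ∀ i, NeZero (d i) := fun i => ⟨hd i⟩
  calc ((n * m * p : ℕ) : ℝ) ^ matMulExponent ≤ (∑ i, (d i : ℝ) ^ matMulExponent) ^ 3 := by
        simpa using h.rpow_matMulExponent_le_sum_rpow_pow_three hρ
    _ ≤ ((maxCharacterDegree G : ℝ) ^ (matMulExponent - 2) * ∑ i, (d i : ℝ) ^ 2) ^ 3 := by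
        gcongr
        exact sum_rpow_le_rpow_mul_sum_sq two_le_matMulExponent (fun i => Nat.cast_nonneg _)
          fun i => Nat.cast_le.2 (le_csSup (bddAbove_characterDegrees G) (hchar i))
    _ = _ := by rw [← hsq]; push_cast; rfl

theorem pseudoExponent_nonneg (G : Type*) [Group G] [Finite G] : 0 ≤ pseudoExponent G := by
  by_cases hG : Nontrivial G
  · obtain ⟨n, m, p, -, -, hα⟩ := (pseudoExponent_isLeast G).1
    rw [hα]
    positivity
  · rw [pseudoExponent, if_neg hG]
    norm_num

theorem matMulExponent_mul_log_card_le (G : Type*) [Group G] [Finite G] [Nontrivial G] :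
    matMulExponent * Real.log (Nat.card G) ≤
      pseudoExponent G *
        ((matMulExponent - 2) * Real.log (maxCharacterDegree G) + Real.log (Nat.card G)) := by
  obtain ⟨n, m, p, hM, h, hα⟩ := (pseudoExponent_isLeast G).1
  have : NeZero (n * m * p) := ⟨by omega⟩
  have hlog : 0 < Real.log (n * m * p : ℕ) := Real.log_pos (by exact_mod_cast hM)
  have hmax : (0 : ℝ) < maxCharacterDegree G := by exact_mod_cast maxCharacterDegree_pos G
  have hcard : (0 : ℝ) < Nat.card G := by exact_mod_cast Nat.card_pos
  have hle := Real.log_le_log (by positivity) h.rpow_matMulExponent_le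
  rw [Real.log_rpow (by positivity), Real.log_pow, Real.log_mul (by positivity) hcard.ne',
    Real.log_rpow hmax, Nat.cast_ofNat] at hle
  rw [eq_div_iff hlog.ne'] at hα
  have hmul := mul_le_mul_of_nonneg_left hle (pseudoExponent_nonneg G)
  linear_combination hmul / 3 - matMulExponent / 3 * hα

theorem matMulExponent_le_pseudoExponent (G : Type*) [Group G] [Finite G] [IsMulCommutative G] :
    matMulExponent ≤ pseudoExponent G := by
  by_cases hG : Nontrivial G
  · have hlog : 0 < Real.log (Nat.card G) := Real.log_pos (by exact_mod_cast Finite.one_lt_card)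
    have h := matMulExponent_mul_log_card_le G
    rw [maxCharacterDegree_eq_one, Nat.cast_one, Real.log_one, mul_zero, zero_add] at h
    exact le_of_mul_le_mul_right h hlog
  · rw [pseudoExponent, if_neg hG]
    exact csInf_le bddBelow_matMulExponents three_mem_matMulExponents

theorem mainTheorem3 (G : Type*) [Group G] [Finite G]
    (h : (pseudoExponent G : EReal) < degreeExponent G) :
    (degreeExponent G ≠ ⊤ →
      matMulExponent ≤ pseudoExponent G *
        (((degreeExponent G).toReal - 2) / ((degreeExponent G).toReal - pseudoExponent G))) ∧
    (degreeExponent G = ⊤ → matMulExponent ≤ pseudoExponent G) := by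
  by_cases hcomm : ∀ a b : G, a * b = b * a
  · have : IsMulCommutative G := ⟨⟨hcomm⟩⟩
    exact ⟨fun hne => absurd (if_pos hcomm) hne, fun _ => matMulExponent_le_pseudoExponent G⟩
  have : Nontrivial G := not_subsingleton_iff_nontrivial.1 fun _ =>
    hcomm fun a b => Subsingleton.elim _ _
  have hγ : degreeExponent G =
      ((Real.log (Nat.card G) / Real.log (maxCharacterDegree G) : ℝ) : EReal) := if_neg hcomm
  refine ⟨fun _ => ?_, fun htop => absurd (hγ.symm.trans htop) (EReal.coe_ne_top _)⟩
  rw [hγ, EReal.coe_lt_coe_iff] at h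
  rw [hγ, EReal.toReal_coe, ← mul_div_assoc, le_div_iff₀ (sub_pos.2 h)]
  have hγ_pos := (pseudoExponent_nonneg G).trans_lt h
  have hmax : 0 < Real.log (maxCharacterDegree G) :=
    (Real.log_natCast_nonneg _).lt_of_ne fun h0 => by simp [← h0] at hγ_pos
  have hbound := matMulExponent_mul_log_card_le G
  rw [← div_mul_cancel₀ (Real.log (Nat.card G)) hmax.ne'] at hbound
  refine le_of_mul_le_mul_right ?_ hmax
  linear_combination hbound
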